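/- For a real Banach space $\mathfrak A$ of finite dimension $n$ with norm $|\cdot|_{\mathfrak A}$ and closed unit ball $K$, and a Borel probability measure $\nu$ on $\mathfrak A$ supported on $K$, let \[\Delta(\nu)=\int_{x\in K}\int_{y\in K}|x-y|_{\mathfrak A}\,\nu(x)\,\nu(y).\] For a centrally symmetric compact convex body $H\subset\mathbb R^n$ let $\Theta(H)$ be its translative covering density, that is, the infimum, over all sets $\Lambda\subset\mathbb R^n$ with $\bigcup_{t\in\Lambda}(t+H)=\mathbb R^n$, of the density \[\liminf_{R\to\infty}\frac{\#\{t\in\Lambda:(t+H)\cap B_R\neq\emptyset\}\cdot\mathrm{vol}(H)}{\mathrm{vol}(B_R)},\] where $B_R$ is the closed Euclidean ball of radius $R$ about the origin. Let \[\Theta_n=\inf_{0<\eta<1/n}(1+\eta)^n\bigl(1+n\log(1/\eta)\bigr)\] be Rogers' bound. (a) Let $n\ge 3$. Then $\Theta(H)\le\Theta_n$ for every centrally symmetric compact convex body $H\subset\mathbb R^n$ (with non-empty interior). Moreover, for every real Banach space of dimension $n$ and every Borel probability measure $\nu$ supported on its closed unit ball, \[\Delta(\nu)<2\left(1-2^{-n}\,\frac{2\left(1-\frac2n\right)}{\mathrm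 e\,n\,\Theta_n}\right),\] and the same inequality holds with $\Theta_n$ replaced by any real number $T$ such that $\Theta(H)\le T$ for all centrally symmetric compact convex bodies $H\subset\mathbb R^n$. (b) There is a function $f:\{2,3,4,\ldots\}\to(0,1]$ with $f(n)=\frac{2(1-2/n)}{\mathrm e\,n\,\Theta_n}$ for $n\ge3$ and $f(n)\sim\frac{2}{\mathrm e\,n^2\log n}$ as $n\to\infty$, such that $\Delta(\nu)\le 2\left(1-2^{-n}f(n)\right)$ for every $n\ge2$, every real Banach space of dimension $n$ and every Borel probability measure $\nu$ supported on its closed unit ball. -/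

import Mathlib

open MeasureTheory Set Filter
open scoped ENNReal Pointwise Asymptotics

noncomputable section

/-- The averaged self-distance `∫_{x ∈ K} ∫_{y ∈ K} |x - y| ν(x) ν(y)` of a measure, `K` being the
closed unit ball. -/
def avgSelfDist {E : Type*} [NormedAddCommGroup E] [MeasurableSpace E] (ν : Measure E) : ℝ :=
  ∫ x in Metric.closedBall (0 : E) 1, ∫ y in Metric.closedBall (0 : E) 1, ‖x - y‖ ∂ν ∂ν

/-- Centrally symmetric compact convex bodies (with non-empty interior) in `ℝⁿ`. -/
structure IsSymmConvexBody {n : ℕ} (H : Set (EuclideanSpace ℝ (Fin n))) : Prop where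
  convex : Convex ℝ H
  isCompact : IsCompact H
  interior_nonempty : (interior H).Nonempty
  neg_eq : -H = H

/-- The (lower) density of the family of translates `t + H`, `t ∈ Λ`: the lower limit, as `R → ∞`,
of the total volume of the translates that meet the ball of radius `R`, divided by the volume of
that ball. -/
def translateDensity {n : ℕ} (H Λ : Set (EuclideanSpace ℝ (Fin n))) : ℝ≥0∞ :=
  liminf (fun R : ℝ =>
    (({t ∈ Λ | ((t +ᵥ H) ∩ Metric.closedBall 0 R).Nonempty}.encard : ℕ∞) : ℝ≥0∞) * volume H /
      volume (Metric.closedBall (0 : EuclideanSpace ℝ (Fin n)) R)) atTop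

/-- The translative covering density `Θ(H)`: the infimum of the densities of the coverings of `ℝⁿ`
by translates of `H`. -/
def coveringDensity {n : ℕ} (H : Set (EuclideanSpace ℝ (Fin n))) : ℝ≥0∞ :=
  ⨅ (Λ : Set (EuclideanSpace ℝ (Fin n))) (_ : ⋃ t ∈ Λ, (t +ᵥ H) = univ), translateDensity H Λ

/-- `T` bounds the translative covering density of every centrally symmetric convex body
in `ℝⁿ`. -/
def IsUniversalCoveringBound (n : ℕ) (T : ℝ) : Prop :=
  ∀ H : Set (EuclideanSpace ℝ (Fin n)), IsSymmConvexBody H →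
    coveringDensity H ≤ ENNReal.ofReal T

/-- Rogers' bound `min_{0 < η < 1/n} (1 + η)^n (1 + n log (1/η))`, written as an infimum
(which is attained for `n ≥ 3`). -/
def rogersBound (n : ℕ) : ℝ :=
  sInf ((fun η : ℝ => (1 + η) ^ n * (1 + n * Real.log (1 / η))) '' Ioo (0 : ℝ) (1 / n))

end

/-!
Suppose the unit ball `K` of an `n`-dimensional space `E` is covered by `N` balls of radius
`h < 1`. By Cauchy–Schwarz two independent `ν`-random points of `K` lie in the same ball with
probability at least `1 / N`; they are then at distance at most `2h` instead of `2`, so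
`Δ(ν) ≤ 2 - (2 - 2h) / N`. Averaging a nearly optimal covering of space by translates of `hK` over
a large ball produces a covering of `K` with `N ≤ (1 + 1 / h)ⁿ T` for every `T` exceeding `Θ(K)`.
The choice `h = n / (n + 2)` is made so that `(1 + 1 / h)ⁿ = 2ⁿ (1 + 1 / n)ⁿ < 2ⁿ e`.

For Rogers' bound, place translates of `K` one after the other in a large cube so that each covers
at least the average share of what is still uncovered, until only a fraction `ηⁿ` of the volume is
left, and then pack as many disjoint translates of `ηK` as possible into the rest. Enlarging all
these bodies to translates of `(1 + η)K` covers the cube, and the covering is continued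
periodically.
-/

section RandomTranslates

variable {G : Type*} [AddCommGroup G]

theorem mem_vadd_set_iff_sub_mem {x a : G} {s : Set G} : x ∈ a +ᵥ s ↔ x - a ∈ s := by
  rw [mem_vadd_set_iff_neg_vadd_mem, vadd_eq_add, neg_add_eq_sub]

theorem preimage_prodMk_setOf_sub_mem (s : Set G) (a : G) :
    Prod.mk a ⁻¹' {p : G × G | p.2 - p.1 ∈ s} = a +ᵥ s := by
  ext x
  exact mem_vadd_set_iff_sub_mem.symm

variable [MeasurableSpace G] [MeasurableAdd₂ G] [MeasurableNeg G] {K : Set G}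

theorem measurable_measure_vadd (κ : Measure G) [SFinite κ] (hK : MeasurableSet K) :
    Measurable fun a : G => κ (a +ᵥ K) := by
  simp_rw [← preimage_prodMk_setOf_sub_mem]
  exact measurable_measure_prodMk_left ((measurable_snd.sub measurable_fst) hK)

theorem lintegral_measure_vadd (μ κ : Measure G) [SFinite μ] [SFinite κ] (hK : MeasurableSet K) :
    ∫⁻ a, κ (a +ᵥ K) ∂μ = ∫⁻ x, μ ((fun a => x - a) ⁻¹' K) ∂κ := by
  have hm : MeasurableSet {p : G × G | p.2 - p.1 ∈ K} := (measurable_snd.sub measurable_fst) hK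
  simp_rw [← preimage_prodMk_setOf_sub_mem]
  rw [← Measure.prod_apply hm, Measure.prod_apply_symm hm]
  rfl

variable {μ : Measure G} [SFinite μ] [μ.IsAddLeftInvariant] [μ.IsNegInvariant]

theorem exists_measure_univ_mul_le_measure_vadd_mul {κ : Measure G} [IsFiniteMeasure κ] {A : Set G}
    (hK : MeasurableSet K) (hA : MeasurableSet A) (hA0 : μ A ≠ 0) (hAtop : μ A ≠ ∞)
    (h : ∀ᵐ x ∂κ, ∀ k ∈ K, x - k ∈ A) :
    ∃ a ∈ A, κ univ * μ K ≤ κ (a +ᵥ K) * μ A := by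
  have hmean : ∫⁻ a in A, κ (a +ᵥ K) ∂μ = κ univ * μ K := by
    rw [lintegral_measure_vadd _ _ hK, mul_comm, ← lintegral_const]
    refine lintegral_congr_ae (h.mono fun x hx => ?_)
    dsimp only
    rw [Measure.restrict_eq_self _ fun a ha => by simpa using hx _ ha,
      (Measure.measurePreserving_sub_left μ x).measure_preimage hK.nullMeasurableSet]
  have hfin : ∫⁻ a in A, κ (a +ᵥ K) ∂μ ≠ ∞ := by
    refine ((lintegral_mono fun a => measure_mono (subset_univ (a +ᵥ K))).trans_lt ?_).ne
    rw [setLIntegral_const]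
    exact ENNReal.mul_lt_top (measure_lt_top _ _) hAtop.lt_top
  obtain ⟨a, ha, hle⟩ := exists_setLAverage_le hA0 hA.nullMeasurableSet hfin
  rw [setLAverage_eq, hmean, ENNReal.div_le_iff hA0 hAtop] at hle
  exact ⟨a, ha, hle⟩

theorem exists_measure_vadd_mul_le_measure_univ_mul (κ : Measure G) [SFinite κ] {B : Set G}
    (hK : MeasurableSet K) (hB0 : μ B ≠ 0) (hBtop : μ B ≠ ∞) :
    ∃ b ∈ B, κ (b +ᵥ K) * μ B ≤ κ univ * μ K := by
  obtain ⟨b, hb, hle⟩ :=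
    exists_le_setLAverage hB0 hBtop (measurable_measure_vadd κ hK).aemeasurable
  rw [setLAverage_eq, ENNReal.le_div_iff_mul_le (Or.inl hB0) (Or.inl hBtop)] at hle
  refine ⟨b, hb, hle.trans ?_⟩
  rw [lintegral_measure_vadd _ _ hK, mul_comm, ← lintegral_const]
  exact lintegral_mono fun x => (Measure.restrict_apply_le _ _).trans_eq
    ((Measure.measurePreserving_sub_left μ x).measure_preimage hK.nullMeasurableSet)

theorem exists_card_filter_vadd_mul_le [DecidablePred (· ∈ K)] (F : Finset G)
    {B : Set G} (hK : MeasurableSet K) (hB0 : μ B ≠ 0) (hBtop : μ B ≠ ∞) :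
    ∃ b ∈ B, ((F.filter fun t => t - b ∈ K).card : ℝ≥0∞) * μ B ≤ F.card * μ K := by
  obtain ⟨b, hb, hle⟩ :=
    exists_measure_vadd_mul_le_measure_univ_mul (∑ t ∈ F, Measure.dirac t) hK hB0 hBtop
  refine ⟨b, hb, ?_⟩
  have hcount : (∑ t ∈ F, Measure.dirac t) (b +ᵥ K) = (F.filter fun t => t - b ∈ K).card := by
    classical
    simp_rw [Measure.finsetSum_apply, Measure.dirac_apply' _ (hK.const_vadd b), indicator_apply,
      mem_vadd_set_iff_sub_mem, Pi.one_apply, Finset.sum_boole]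
  simpa [hcount] using hle

theorem exists_measureReal_sdiff_vadd_le {A S : Set G} (hK : MeasurableSet K)
    (hA : MeasurableSet A) (hA0 : μ A ≠ 0) (hAtop : μ A ≠ ∞) (hStop : μ S ≠ ∞)
    (hS : MeasurableSet S) (hSA : ∀ x ∈ S, ∀ k ∈ K, x - k ∈ A) :
    ∃ a : G, μ.real (S \ (a +ᵥ K)) ≤ μ.real S * Real.exp (-(μ.real K / μ.real A)) := by
  have := isFiniteMeasure_restrict.2 hStop
  obtain ⟨a, -, ha⟩ := exists_measure_univ_mul_le_measure_vadd_mul (κ := μ.restrict S) hK hA hA0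
    hAtop ((ae_restrict_iff' hS).2 (.of_forall hSA))
  rw [Measure.restrict_apply_univ, Measure.restrict_apply (hK.const_vadd a), inter_comm] at ha
  have hAr : 0 < μ.real A := ENNReal.toReal_pos hA0 hAtop
  have hcovered : μ.real S * (μ.real K / μ.real A) ≤ μ.real (S ∩ (a +ᵥ K)) := by
    rw [← mul_div_assoc, div_le_iff₀ hAr]
    simpa only [measureReal_def, ENNReal.toReal_mul] using ENNReal.toReal_mono
      (ENNReal.mul_ne_top (measure_ne_top_of_subset inter_subset_left hStop) hAtop) ha
  refine ⟨a, ?_⟩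
  calc μ.real (S \ (a +ᵥ K)) ≤ μ.real S * (-(μ.real K / μ.real A) + 1) := by
        linarith [measureReal_inter_add_sdiff (μ := μ) (s := S) (hK.const_vadd a) hStop]
    _ ≤ μ.real S * Real.exp (-(μ.real K / μ.real A)) := by
        gcongr
        exact Real.add_one_le_exp _

theorem exists_finset_measureReal_sdiff_le {A S : Set G} (hK : MeasurableSet K)
    (hA : MeasurableSet A) (hA0 : μ A ≠ 0) (hAtop : μ A ≠ ∞) (hStop : μ S ≠ ∞)
    (hS : MeasurableSet S) (hSA : ∀ x ∈ S, ∀ k ∈ K, x - k ∈ A) (N : ℕ) :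
    ∃ F : Finset G, F.card ≤ N ∧ μ.real (S \ ⋃ a ∈ F, (a +ᵥ K)) ≤
      μ.real S * Real.exp (-(μ.real K / μ.real A)) ^ N := by
  classical
  induction N with
  | zero => exact ⟨∅, by simp⟩
  | succ N ih =>
    obtain ⟨F, hF, hle⟩ := ih
    obtain ⟨a, ha⟩ := exists_measureReal_sdiff_vadd_le hK hA hA0 hAtop
      (measure_ne_top_of_subset sdiff_subset hStop)
      (hS.diff (Finset.measurableSet_biUnion F fun a _ => hK.const_vadd a))
      fun x hx => hSA x hx.1
    refine ⟨insert a F, (Finset.card_insert_le _ _).trans (by omega), ?_⟩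
    rw [Finset.set_biUnion_insert, union_comm, ← sdiff_sdiff, pow_succ, ← mul_assoc]
    exact ha.trans (by gcongr)

theorem exists_finset_card_mul_le_measureReal_sdiff_le {A S : Set G} (hK : MeasurableSet K)
    (hK0 : μ K ≠ 0) (hKtop : μ K ≠ ∞) (hA : MeasurableSet A) (hA0 : μ A ≠ 0) (hAtop : μ A ≠ ∞)
    (hStop : μ S ≠ ∞) (hS : MeasurableSet S) (hSA : ∀ x ∈ S, ∀ k ∈ K, x - k ∈ A)
    {L : ℝ} (hL : 0 ≤ L) :
    ∃ F : Finset G, F.card * μ.real K ≤ L * μ.real A + μ.real K ∧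
      μ.real (S \ ⋃ a ∈ F, (a +ᵥ K)) ≤ μ.real S * Real.exp (-L) := by
  have hKr : 0 < μ.real K := ENNReal.toReal_pos hK0 hKtop
  have hAr : 0 < μ.real A := ENNReal.toReal_pos hA0 hAtop
  set N := ⌈L * μ.real A / μ.real K⌉₊
  obtain ⟨F, hFN, hF⟩ := exists_finset_measureReal_sdiff_le hK hA hA0 hAtop hStop hS hSA N
  refine ⟨F, ?_, hF.trans ?_⟩
  · calc F.card * μ.real K ≤ N * μ.real K := by gcongr
      _ ≤ (L * μ.real A / μ.real K + 1) * μ.real K := by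
          gcongr
          exact (Nat.ceil_lt_add_one (by positivity)).le
      _ = L * μ.real A + μ.real K := by field_simp
  · have hN : L * μ.real A ≤ N * μ.real K := (div_le_iff₀ hKr).1 (Nat.le_ceil _)
    rw [← Real.exp_nat_mul, mul_neg, ← mul_div_assoc]
    gcongr
    exact (le_div_iff₀ hAr).2 hN

end RandomTranslates

section Packing

variable {G : Type*} [AddGroup G] [MeasurableSpace G] [MeasurableAdd G] {μ : Measure G}
  [μ.IsAddLeftInvariant] {P S : Set G}

theorem encard_mul_measure_le_of_pairwiseDisjoint_vadd (hP : MeasurableSet P) {V : Set G}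
    (hV : V.PairwiseDisjoint fun v => v +ᵥ P) (hVS : ∀ v ∈ V, v +ᵥ P ⊆ S) :
    (V.encard : ℝ≥0∞) * μ P ≤ μ S :=
  calc (V.encard : ℝ≥0∞) * μ P = ∑' v : V, μ ((v : G) +ᵥ P) := by
        simp only [measure_vadd, ENNReal.tsum_set_const]
    _ ≤ μ (⋃ v : V, ((v : G) +ᵥ P)) :=
        tsum_meas_le_meas_iUnion_of_disjoint μ (fun v => hP.const_vadd (v : G))
          fun v w hvw => hV v.2 w.2 (Subtype.coe_injective.ne hvw)
    _ ≤ μ S := measure_mono (iUnion_subset fun v => hVS v v.2)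

theorem exists_finset_maximal_packing (hP : MeasurableSet P) (hP0 : μ P ≠ 0) (hStop : μ S ≠ ∞) :
    ∃ F : Finset G, F.card * μ P ≤ μ S ∧
      ∀ x : G, x +ᵥ P ⊆ S → ∃ b ∈ F, ((x +ᵥ P) ∩ (b +ᵥ P)).Nonempty := by
  obtain ⟨V, hVS, hV, hmax⟩ := Vitali.exists_disjoint_subfamily_covering_enlargement
    (fun v : G => v +ᵥ P) {v | v +ᵥ P ⊆ S} 0 2 one_lt_two (fun _ _ => le_rfl) 0
    (fun _ _ => le_rfl) (fun _ _ => (nonempty_of_measure_ne_zero hP0).vadd_set)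
  have hcard := encard_mul_measure_le_of_pairwiseDisjoint_vadd (μ := μ) hP hV hVS
  have hVfin : V.Finite := by
    by_contra hinf
    rw [Set.Infinite.encard_eq hinf, ENat.toENNReal_top, ENNReal.top_mul hP0] at hcard
    exact hStop (top_le_iff.1 hcard)
  refine ⟨hVfin.toFinset, ?_, fun x hx => ?_⟩
  · rwa [hVfin.encard_eq_coe_toFinset_card, ENat.toENNReal_coe] at hcard
  · obtain ⟨b, hb, hxb, -⟩ := hmax x hx
    exact ⟨b, hVfin.mem_toFinset.2 hb, hxb⟩

end Packing

section AveragedKernel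

variable {X : Type*} [MeasurableSpace X] {μ : Measure X} [IsFiniteMeasure μ] {f : X → X → ℝ}
  {D d : ℝ}

theorem integral_integral_le_of_pairwise_disjoint {ι : Type*} [Fintype ι] {A : ι → Set X}
    (hf : ∀ x y, 0 ≤ f x y) (hD : ∀ᵐ x ∂μ, ∀ᵐ y ∂μ, f x y ≤ D)
    (hAm : ∀ i, MeasurableSet (A i)) (hA : Pairwise (Function.onFun Disjoint A))
    (hcover : ∀ᵐ x ∂μ, ∃ i, x ∈ A i) (hd : ∀ i, ∀ x ∈ A i, ∀ y ∈ A i, f x y ≤ d) :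
    ∫ x, ∫ y, f x y ∂μ ∂μ ≤ D * μ.real univ ^ 2 - (D - d) * ∑ i, μ.real (A i) ^ 2 := by
  have hind (i : ι) : Integrable ((A i).indicator (1 : X → ℝ)) μ :=
    (integrable_const (1 : ℝ)).indicator (hAm i)
  have hsum : Integrable (fun x => ∑ i, μ.real (A i) * (A i).indicator (1 : X → ℝ) x) μ :=
    integrable_finsetSum _ fun i _ => (hind i).const_mul _
  have hinner : ∀ᵐ x ∂μ, ∫ y, f x y ∂μ ≤
      D * μ.real univ - (D - d) * ∑ i, μ.real (A i) * (A i).indicator 1 x := by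
    filter_upwards [hD, hcover] with x hxD ⟨i, hi⟩
    have hpiece : ∑ j, μ.real (A j) * (A j).indicator (1 : X → ℝ) x = μ.real (A i) := by
      rw [Finset.sum_eq_single_of_mem i (Finset.mem_univ i), indicator_of_mem hi, Pi.one_apply,
        mul_one]
      intro j _ hj
      rw [indicator_of_notMem fun hxj => (hA hj).le_bot ⟨hxj, hi⟩, mul_zero]
    calc ∫ y, f x y ∂μ ≤ ∫ y, (D - (D - d) * (A i).indicator 1 y) ∂μ := by
          refine integral_mono_of_nonneg (.of_forall (hf x))
            ((integrable_const _).sub ((hind i).const_mul _)) (hxD.mono fun y hy => ?_)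
          by_cases hyi : y ∈ A i
          · simpa [hyi] using hd i x hi y hyi
          · simpa [hyi] using hy
      _ = D * μ.real univ - (D - d) * ∑ j, μ.real (A j) * (A j).indicator 1 x := by
          rw [hpiece, integral_sub (integrable_const _) ((hind i).const_mul _), integral_const,
            integral_const_mul, integral_indicator_one (hAm i), smul_eq_mul, mul_comm]
  calc ∫ x, ∫ y, f x y ∂μ ∂μ
      ≤ ∫ x, (D * μ.real univ - (D - d) * ∑ i, μ.real (A i) * (A i).indicator 1 x) ∂μ :=
        integral_mono_of_nonneg (.of_forall fun x => integral_nonneg (hf x))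
          ((integrable_const _).sub (hsum.const_mul _)) hinner
    _ = D * μ.real univ ^ 2 - (D - d) * ∑ i, μ.real (A i) ^ 2 := by
        rw [integral_sub (integrable_const _) (hsum.const_mul _), integral_const,
          integral_const_mul, integral_finsetSum _ fun i _ => (hind i).const_mul _]
        simp_rw [integral_const_mul, integral_indicator_one (hAm _), smul_eq_mul]
        ring_nf

theorem integral_integral_le_of_cover {N : ℕ} {A : Fin N → Set X} (hf : ∀ x y, 0 ≤ f x y)
    (hD : ∀ᵐ x ∂μ, ∀ᵐ y ∂μ, f x y ≤ D) (hAm : ∀ i, MeasurableSet (A i))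
    (hcover : ∀ᵐ x ∂μ, ∃ i, x ∈ A i) (hd : ∀ i, ∀ x ∈ A i, ∀ y ∈ A i, f x y ≤ d) (hdD : d ≤ D) :
    ∫ x, ∫ y, f x y ∂μ ∂μ ≤ (D - (D - d) / N) * μ.real univ ^ 2 := by
  let P : Fin N → Set X := disjointed A
  have hPA (i : Fin N) : P i ⊆ A i := disjointed_subset A i
  have hPm (i : Fin N) : MeasurableSet (P i) :=
    disjointedRec (fun _ j ht => ht.diff (hAm j)) (hAm i)
  have hPcover : ∀ᵐ x ∂μ, ∃ i, x ∈ P i := by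
    simpa only [← mem_iUnion, P, iUnion_disjointed] using hcover
  have hmass : ∑ i, μ.real (P i) = μ.real univ := by
    rw [← measureReal_iUnion_fintype (disjoint_disjointed A) hPm]
    exact measureReal_congr (eventuallyEq_univ.2 (hPcover.mono fun x hx => mem_iUnion.2 hx))
  have hCauchySchwarz : μ.real univ ^ 2 / N ≤ ∑ i, μ.real (P i) ^ 2 := by
    refine div_le_of_le_mul₀ N.cast_nonneg (Finset.sum_nonneg fun i _ => sq_nonneg _) ?_
    simpa [hmass, mul_comm] using
      sq_sum_le_card_mul_sum_sq (s := Finset.univ) (f := fun i => μ.real (P i))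
  calc ∫ x, ∫ y, f x y ∂μ ∂μ ≤ D * μ.real univ ^ 2 - (D - d) * ∑ i, μ.real (P i) ^ 2 :=
        integral_integral_le_of_pairwise_disjoint hf hD hPm (disjoint_disjointed A) hPcover
          fun i x hx y hy => hd i x (hPA i hx) y (hPA i hy)
    _ ≤ D * μ.real univ ^ 2 - (D - d) * (μ.real univ ^ 2 / N) := by
        gcongr
    _ = (D - (D - d) / N) * μ.real univ ^ 2 := by ring

theorem avgSelfDist_le_of_subset_iUnion_closedBall {E : Type*} [NormedAddCommGroup E]
    [MeasurableSpace E] [OpensMeasurableSpace E] {ν : Measure E}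
    (hν : ν (Metric.closedBall 0 1) ≤ 1) {N : ℕ} (c : Fin N → E) {h : ℝ} (hh0 : 0 ≤ h)
    (hh1 : h ≤ 1) (hc : Metric.closedBall (0 : E) 1 ⊆ ⋃ i, Metric.closedBall (c i) h) :
    avgSelfDist ν ≤ 2 - (2 - 2 * h) / N := by
  let K := Metric.closedBall (0 : E) 1
  have : IsFiniteMeasure (ν.restrict K) :=
    isFiniteMeasure_restrict.2 (hν.trans_lt ENNReal.one_lt_top).ne
  have hK : ∀ᵐ x ∂ν.restrict K, x ∈ K := ae_restrict_mem Metric.isClosed_closedBall.measurableSet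
  have hmass : (ν.restrict K).real univ ≤ 1 := by
    rw [measureReal_restrict_apply_univ]
    exact ENNReal.toReal_le_of_le_ofReal zero_le_one (by simpa using hν)
  have hN : (1 : ℝ) ≤ N := by
    obtain ⟨i, -⟩ := mem_iUnion.1 (hc (Metric.mem_closedBall_self zero_le_one))
    exact_mod_cast i.pos
  have hgain : (2 - 2 * h) / N ≤ 2 - 2 * h := div_le_self (by linarith) hN
  calc avgSelfDist ν ≤ (2 - (2 - 2 * h) / N) * (ν.restrict K).real univ ^ 2 := by
        refine integral_integral_le_of_cover (fun x y => norm_nonneg _) ?_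
          (fun i => Metric.isClosed_closedBall.measurableSet)
          (hK.mono fun x hx => mem_iUnion.1 (hc hx)) (fun i x hx y hy => ?_) (by linarith)
        · filter_upwards [hK] with x hx
          filter_upwards [hK] with y hy
          rw [mem_closedBall_zero_iff] at hx hy
          linarith [norm_sub_le x y]
        · rw [← dist_eq_norm]
          linarith [dist_triangle_right x y (c i), Metric.mem_closedBall.1 hx,
            Metric.mem_closedBall.1 hy]
    _ ≤ 2 - (2 - 2 * h) / N :=
        mul_le_of_le_one_right (by linarith) (pow_le_one₀ measureReal_nonneg hmass)

end AveragedKernel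

namespace IsSymmConvexBody

variable {n : ℕ} {K : Set (EuclideanSpace ℝ (Fin n))}

theorem neg_mem (hK : IsSymmConvexBody K) {x : EuclideanSpace ℝ (Fin n)} (hx : x ∈ K) :
    -x ∈ K := by
  rwa [← Set.mem_neg, hK.neg_eq]

theorem balanced (hK : IsSymmConvexBody K) : Balanced ℝ K :=
  (balanced_iff_neg_mem hK.convex).2 fun _ => hK.neg_mem

theorem zero_mem (hK : IsSymmConvexBody K) : (0 : EuclideanSpace ℝ (Fin n)) ∈ K :=
  hK.balanced.zero_mem (hK.interior_nonempty.mono interior_subset)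

theorem volume_ne_zero (hK : IsSymmConvexBody K) : volume K ≠ 0 :=
  (Measure.measure_pos_of_nonempty_interior _ hK.interior_nonempty).ne'

theorem volume_ne_top (hK : IsSymmConvexBody K) : volume K ≠ ∞ :=
  hK.isCompact.measure_lt_top.ne

theorem measurableSet (hK : IsSymmConvexBody K) : MeasurableSet K :=
  hK.isCompact.measurableSet

theorem smul (hK : IsSymmConvexBody K) {r : ℝ} (hr : r ≠ 0) : IsSymmConvexBody (r • K) where
  convex := hK.convex.smul r
  isCompact := hK.isCompact.smul r
  interior_nonempty := by
    rw [interior_smul₀ hr]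
    exact hK.interior_nonempty.smul_set
  neg_eq := by rw [← smul_set_neg, hK.neg_eq]

theorem sub_mem_smul (hK : IsSymmConvexBody K) {p q : ℝ} (hp : 0 ≤ p) (hq : 0 ≤ q)
    {x y : EuclideanSpace ℝ (Fin n)} (hx : x ∈ p • K) (hy : y ∈ q • K) : x - y ∈ (p + q) • K := by
  rw [← hK.neg_eq, smul_set_neg] at hy
  rw [hK.convex.add_smul hp hq, sub_eq_add_neg]
  exact add_mem_add hx hy

end IsSymmConvexBody

theorem isSymmConvexBody_image_closedBall {E : Type*} [NormedAddCommGroup E] [NormedSpace ℝ E]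
    [FiniteDimensional ℝ E] {n : ℕ} (e : E ≃L[ℝ] EuclideanSpace ℝ (Fin n)) {r : ℝ} (hr : 0 < r) :
    IsSymmConvexBody (e '' Metric.closedBall (0 : E) r) where
  convex := (convex_closedBall _ _).linear_image e.toLinearEquiv.toLinearMap
  isCompact :=
    have := FiniteDimensional.proper ℝ E
    (isCompact_closedBall _ _).image e.continuous
  interior_nonempty :=
    ⟨e 0, (e.toHomeomorph.image_interior _).subset
      (mem_image_of_mem e (Metric.ball_subset_interior_closedBall (Metric.mem_ball_self hr)))⟩
  neg_eq := by
    rw [← image_neg_of_apply_neg_eq_neg fun x _ => map_neg e x, neg_closedBall, neg_zero]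

section CoverFromDensity

variable {n : ℕ}

theorem tendsto_one_add_div_pow_atTop (n : ℕ) (a : ℝ) :
    Tendsto (fun s : ℝ => (1 + a / s) ^ n) atTop (nhds 1) := by
  simpa using ((tendsto_id.const_div_atTop a).const_add 1).pow n

theorem tendsto_volume_closedBall_add_div (c : ℝ) :
    Tendsto (fun R : ℝ => volume (Metric.closedBall (0 : EuclideanSpace ℝ (Fin n)) (R + c)) /
      volume (Metric.closedBall (0 : EuclideanSpace ℝ (Fin n)) R)) atTop (nhds 1) := by
  have hlim := ENNReal.tendsto_ofReal (tendsto_one_add_div_pow_atTop n c)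
  rw [ENNReal.ofReal_one] at hlim
  refine hlim.congr' ?_
  filter_upwards [eventually_gt_atTop 0, eventually_gt_atTop (-c)] with R hR hRc
  rw [Measure.addHaar_closedBall _ _ hR.le, Measure.addHaar_closedBall _ _ (by linarith),
    ENNReal.mul_div_mul_right _ _ (Metric.measure_ball_pos _ _ one_pos).ne'
      measure_ball_lt_top.ne, ← ENNReal.ofReal_div_of_pos (by positivity), ← div_pow, add_div,
    div_self hR.ne', finrank_euclideanSpace_fin]

theorem exists_finset_cover_closedBall_of_coveringDensity_lt
    {H : Set (EuclideanSpace ℝ (Fin n))} (hH : volume H ≠ 0) {T : ℝ≥0∞}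
    (hT : coveringDensity H < T) (c : ℝ) :
    ∃ r > 0, ∃ G : Finset (EuclideanSpace ℝ (Fin n)),
      Metric.closedBall 0 (r + c) ⊆ ⋃ t ∈ G, (t +ᵥ H) ∧
      G.card * volume H ≤ T * volume (Metric.closedBall (0 : EuclideanSpace ℝ (Fin n)) r) := by
  obtain ⟨T₁, hT₁, hT₁T⟩ := exists_between hT
  simp only [coveringDensity, iInf_lt_iff] at hT₁
  obtain ⟨Λ, hΛ, hlim⟩ := hT₁
  have hratio : ∀ᶠ R : ℝ in atTop,
      T₁ * (volume (Metric.closedBall (0 : EuclideanSpace ℝ (Fin n)) R) /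
        volume (Metric.closedBall (0 : EuclideanSpace ℝ (Fin n)) (R - c))) < T := by
    have h := ENNReal.Tendsto.const_mul (a := T₁)
      ((tendsto_volume_closedBall_add_div (n := n) c).comp
        (tendsto_atTop_add_const_right atTop (-c) tendsto_id)) (Or.inl one_ne_zero)
    rw [mul_one] at h
    filter_upwards [h.eventually_lt_const hT₁T] with R hR
    simpa [sub_eq_add_neg] using hR
  obtain ⟨R, ⟨hcount, hR⟩, hR0, hRc⟩ :=
    (((frequently_lt_of_liminf_lt (by isBoundedDefault) hlim).and_eventually hratio).and_eventually
      ((eventually_gt_atTop 0).and (eventually_gt_atTop c))).exists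
  rw [ENNReal.div_lt_iff (Or.inl (Metric.measure_closedBall_pos _ _ hR0).ne')
    (Or.inl measure_closedBall_lt_top.ne)] at hcount
  rw [← mul_div_assoc, ENNReal.div_lt_iff
    (Or.inl (Metric.measure_closedBall_pos _ _ (sub_pos.2 hRc)).ne')
    (Or.inl measure_closedBall_lt_top.ne)] at hR
  set G := {t ∈ Λ | ((t +ᵥ H) ∩ Metric.closedBall 0 R).Nonempty}
  have hG : G.Finite := by
    by_contra hinf
    rw [Set.Infinite.encard_eq hinf, ENat.toENNReal_top, ENNReal.top_mul hH] at hcount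
    exact not_top_lt hcount
  rw [hG.encard_eq_coe_toFinset_card, ENat.toENNReal_coe] at hcount
  refine ⟨R - c, sub_pos.2 hRc, hG.toFinset, fun x hx => ?_, (hcount.trans hR).le⟩
  rw [sub_add_cancel] at hx
  obtain ⟨t, ht, hxt⟩ := mem_iUnion₂.1 (hΛ.ge (mem_univ x))
  exact mem_iUnion₂.2 ⟨t, hG.mem_toFinset.2 ⟨ht, x, hxt, hx⟩, hxt⟩

theorem IsSymmConvexBody.subset_iUnion_sub_vadd_smul {K : Set (EuclideanSpace ℝ (Fin n))}
    (hK : IsSymmConvexBody K) {h : ℝ} (hh : 0 ≤ h) {G : Set (EuclideanSpace ℝ (Fin n))}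
    {x : EuclideanSpace ℝ (Fin n)} (hG : x +ᵥ K ⊆ ⋃ t ∈ G, (t +ᵥ h • K)) :
    K ⊆ ⋃ t ∈ {t ∈ G | t - x ∈ (1 + h) • K}, ((t - x) +ᵥ h • K) := by
  intro k hk
  obtain ⟨t, ht, hxk⟩ := mem_iUnion₂.1 (hG (vadd_mem_vadd_set hk))
  rw [mem_vadd_set_iff_sub_mem, vadd_eq_add] at hxk
  refine mem_iUnion₂.2 ⟨t, ⟨ht, ?_⟩, ?_⟩
  · convert hK.sub_mem_smul zero_le_one hh (by rwa [one_smul]) hxk (x := k) using 1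
    abel
  · rw [mem_vadd_set_iff_sub_mem]
    convert hxk using 1
    abel

theorem IsSymmConvexBody.exists_finset_subset_iUnion_vadd_smul
    {K : Set (EuclideanSpace ℝ (Fin n))} (hK : IsSymmConvexBody K) {h : ℝ} (hh : 0 < h)
    {T : ℝ≥0∞} (hT : coveringDensity (h • K) < T) :
    ∃ F : Finset (EuclideanSpace ℝ (Fin n)), K ⊆ ⋃ t ∈ F, (t +ᵥ h • K) ∧
      F.card * ENNReal.ofReal (h ^ n) ≤ T * ENNReal.ofReal ((1 + h) ^ n) := by
  classical
  obtain ⟨c, hc⟩ := hK.isCompact.isBounded.exists_norm_le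
  obtain ⟨r, hr, G, hGcover, hGcard⟩ := exists_finset_cover_closedBall_of_coveringDensity_lt
    (hK.smul hh.ne').volume_ne_zero hT c
  set b := volume (Metric.closedBall (0 : EuclideanSpace ℝ (Fin n)) r)
  have hb0 : b ≠ 0 := (Metric.measure_closedBall_pos _ _ hr).ne'
  have hbtop : b ≠ ∞ := measure_closedBall_lt_top.ne
  obtain ⟨x, hx, hle⟩ := exists_card_filter_vadd_mul_le G
    (hK.smul (by positivity : 1 + h ≠ 0)).measurableSet hb0 hbtop
  set F := G.filter fun t => t - x ∈ (1 + h) • K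
  have hxK : x +ᵥ K ⊆ ⋃ t ∈ (G : Set (EuclideanSpace ℝ (Fin n))), (t +ᵥ h • K) := by
    rintro _ ⟨k, hk, rfl⟩
    refine hGcover (mem_closedBall_zero_iff.2 ((norm_add_le x k).trans ?_))
    exact add_le_add (mem_closedBall_zero_iff.1 hx) (hc k hk)
  refine ⟨F.image fun t => t - x, ?_, ?_⟩
  · simpa [F] using hK.subset_iUnion_sub_vadd_smul hh.le hxK
  · rw [Measure.addHaar_smul_of_nonneg _ hh.le, finrank_euclideanSpace_fin] at hGcard
    rw [Measure.addHaar_smul_of_nonneg _ (by positivity), finrank_euclideanSpace_fin] at hle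
    refine (ENNReal.mul_le_mul_iff_left (mul_ne_zero hb0 hK.volume_ne_zero)
      (ENNReal.mul_ne_top hbtop hK.volume_ne_top)).1 ?_
    calc ((F.image fun t => t - x).card : ℝ≥0∞) * ENNReal.ofReal (h ^ n) * (b * volume K)
        ≤ F.card * ENNReal.ofReal (h ^ n) * (b * volume K) := by
          have hcard : (F.image fun t => t - x).card ≤ F.card := Finset.card_image_le
          gcongr
      _ = F.card * b * (ENNReal.ofReal (h ^ n) * volume K) := by ring
      _ ≤ G.card * (ENNReal.ofReal ((1 + h) ^ n) * volume K) *
            (ENNReal.ofReal (h ^ n) * volume K) := by gcongr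
      _ = G.card * (ENNReal.ofReal (h ^ n) * volume K) *
            (ENNReal.ofReal ((1 + h) ^ n) * volume K) := by ring
      _ ≤ T * b * (ENNReal.ofReal ((1 + h) ^ n) * volume K) := by gcongr
      _ = T * ENNReal.ofReal ((1 + h) ^ n) * (b * volume K) := by ring

end CoverFromDensity

section UniversalBound

variable {n : ℕ} {T : ℝ}

theorem IsUniversalCoveringBound.exists_cover_closedBall (hT : IsUniversalCoveringBound n T)
    {S : ℝ} (hS : 0 < S) (hTS : T < S) {E : Type*} [NormedAddCommGroup E] [NormedSpace ℝ E]
    [FiniteDimensional ℝ E] (hE : Module.finrank ℝ E = n) {h : ℝ} (hh : 0 < h) :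
    ∃ (N : ℕ) (c : Fin N → E), N ≤ S * (1 + 1 / h) ^ n ∧
      Metric.closedBall (0 : E) 1 ⊆ ⋃ i, Metric.closedBall (c i) h := by
  let e : E ≃L[ℝ] EuclideanSpace ℝ (Fin n) :=
    ContinuousLinearEquiv.ofFinrankEq (by rw [hE, finrank_euclideanSpace_fin])
  have hK := isSymmConvexBody_image_closedBall e one_pos
  obtain ⟨F, hF, hcard⟩ := hK.exists_finset_subset_iUnion_vadd_smul hh
    ((hT _ (hK.smul hh.ne')).trans_lt ((ENNReal.ofReal_lt_ofReal_iff hS).2 hTS))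
  refine ⟨F.card, fun i => e.symm (F.equivFin.symm i), ?_, fun x hx => ?_⟩
  · rw [← ENNReal.ofReal_natCast, ← ENNReal.ofReal_mul (by positivity),
      ← ENNReal.ofReal_mul hS.le, ENNReal.ofReal_le_ofReal_iff (by positivity),
      ← le_div_iff₀ (by positivity), mul_div_assoc, ← div_pow, add_div, div_self hh.ne',
      add_comm] at hcard
    exact hcard
  · obtain ⟨t, ht, _, ⟨_, ⟨w, hw, rfl⟩, rfl⟩, hxt⟩ := mem_iUnion₂.1 (hF (mem_image_of_mem e hx))
    have hx' : x = e.symm t + h • w := e.injective (by simpa using hxt.symm)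
    refine mem_iUnion.2 ⟨F.equivFin ⟨t, ht⟩, ?_⟩
    rw [mem_closedBall_zero_iff] at hw
    simpa [hx', norm_smul, abs_of_pos hh] using mul_le_of_le_one_right hh.le hw

theorem IsUniversalCoveringBound.pos (hT : IsUniversalCoveringBound n T) : 0 < T := by
  by_contra! hT0
  obtain ⟨N, c, hN, hcover⟩ := hT.exists_cover_closedBall (S := 2⁻¹ / 2 ^ n) (by positivity)
    (hT0.trans_lt (by positivity)) finrank_euclideanSpace_fin one_pos
  obtain ⟨i, -⟩ := mem_iUnion.1 (hcover (Metric.mem_closedBall_self zero_le_one))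
  have hN1 : (1 : ℝ) ≤ N := by exact_mod_cast i.pos
  have hN2 : (N : ℝ) ≤ 2⁻¹ := by
    rwa [div_one, one_add_one_eq_two, div_mul_cancel₀ _ (by positivity)] at hN
  linarith

theorem one_add_one_div_pow_lt_exp_one (hn : n ≠ 0) : (1 + 1 / (n : ℝ)) ^ n < Real.exp 1 :=
  calc (1 + 1 / (n : ℝ)) ^ n < Real.exp (1 / n) ^ n := by
        refine pow_lt_pow_left₀ ?_ (by positivity) hn
        rw [add_comm]
        exact Real.add_one_lt_exp (by positivity)
    _ = Real.exp 1 := by rw [← Real.exp_nat_mul, mul_one_div_cancel (by exact_mod_cast hn)]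

theorem IsUniversalCoveringBound.exists_cover_closedBall_card_lt
    (hT : IsUniversalCoveringBound n T) (hn : n ≠ 0) {E : Type*} [NormedAddCommGroup E]
    [NormedSpace ℝ E] [FiniteDimensional ℝ E] (hE : Module.finrank ℝ E = n) :
    ∃ (N : ℕ) (c : Fin N → E), (N : ℝ) < 2 ^ n * (Real.exp 1 * T) ∧
      Metric.closedBall (0 : E) 1 ⊆ ⋃ i, Metric.closedBall (c i) (n / (n + 2) : ℝ) := by
  have hq : 0 < (1 + 1 / (n : ℝ)) ^ n := by positivity
  obtain ⟨S, hTS, hS⟩ : ∃ S, T < S ∧ S < Real.exp 1 * T / (1 + 1 / (n : ℝ)) ^ n :=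
    exists_between <| (lt_div_iff₀' hq).2 <|
      mul_lt_mul_of_pos_right (one_add_one_div_pow_lt_exp_one hn) hT.pos
  obtain ⟨N, c, hN, hcover⟩ := hT.exists_cover_closedBall (hT.pos.trans hTS) hTS hE
    (h := n / (n + 2)) (by positivity)
  refine ⟨N, c, hN.trans_lt ?_, hcover⟩
  have hradius : 1 + 1 / ((n : ℝ) / (n + 2)) = 2 * (1 + 1 / n) := by field_simp; ring
  calc S * (1 + 1 / ((n : ℝ) / (n + 2))) ^ n = 2 ^ n * (S * (1 + 1 / (n : ℝ)) ^ n) := by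
        rw [hradius, mul_pow]; ring
    _ < 2 ^ n * (Real.exp 1 * T) := by
        exact mul_lt_mul_of_pos_left ((lt_div_iff₀ hq).1 hS) (by positivity)

theorem IsUniversalCoveringBound.avgSelfDist_lt (hT : IsUniversalCoveringBound n T) (hn : n ≠ 0)
    {E : Type*} [NormedAddCommGroup E] [NormedSpace ℝ E] [MeasurableSpace E]
    [OpensMeasurableSpace E] (hE : Module.finrank ℝ E = n) {ν : Measure E}
    (hν : ν (Metric.closedBall 0 1) ≤ 1) :
    avgSelfDist ν < 2 * (1 - (2 : ℝ)⁻¹ ^ n * (2 / (Real.exp 1 * (n + 2) * T))) := by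
  have : FiniteDimensional ℝ E := Module.finite_of_finrank_pos (by omega)
  obtain ⟨N, c, hN, hcover⟩ := hT.exists_cover_closedBall_card_lt hn hE
  have hN0 : (0 : ℝ) < N := by
    obtain ⟨i, -⟩ := mem_iUnion.1 (hcover (Metric.mem_closedBall_self zero_le_one))
    exact_mod_cast i.pos
  have hT0 := hT.pos
  have hgain : 2 - 2 * ((n : ℝ) / (n + 2)) = 4 / (n + 2) := by field_simp; ring
  calc avgSelfDist ν ≤ 2 - 4 / (n + 2) / N := by
        rw [← hgain]
        exact avgSelfDist_le_of_subset_iUnion_closedBall hν c (by positivity)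
          (div_le_one_of_le₀ (by linarith) (by positivity)) hcover
    _ < 2 - 4 / (n + 2) / (2 ^ n * (Real.exp 1 * T)) := by gcongr
    _ = 2 * (1 - (2 : ℝ)⁻¹ ^ n * (2 / (Real.exp 1 * (n + 2) * T))) := by
        rw [inv_pow]; field_simp; ring

theorem IsUniversalCoveringBound.avgSelfDist_lt_of_le (hT : IsUniversalCoveringBound n T)
    (hn : n ≠ 0) {δ : ℝ} (hδ : δ ≤ 2 / (Real.exp 1 * (n + 2) * T)) {E : Type*}
    [NormedAddCommGroup E] [NormedSpace ℝ E] [MeasurableSpace E] [OpensMeasurableSpace E]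
    (hE : Module.finrank ℝ E = n) {ν : Measure E} (hν : ν (Metric.closedBall 0 1) ≤ 1) :
    avgSelfDist ν < 2 * (1 - (2 : ℝ)⁻¹ ^ n * δ) :=
  (hT.avgSelfDist_lt hn hE hν).trans_le (by gcongr)

end UniversalBound

section Tiling

variable {n : ℕ} {H D V : Set (EuclideanSpace ℝ (Fin n))} {F : Finset (EuclideanSpace ℝ (Fin n))}

theorem iUnion_vadd_add_eq_univ {G : Type*} [AddCommGroup G] {H D V F : Set G}
    (hV : ⋃ v ∈ V, (v +ᵥ D) = univ) (hF : D ⊆ ⋃ t ∈ F, (t +ᵥ H)) :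
    ⋃ t ∈ F + V, (t +ᵥ H) = univ := by
  rw [iUnion_vadd_left_image, vadd_eq_add] at hV hF ⊢
  refine eq_univ_of_univ_subset ?_
  calc univ = V + D := hV.symm
    _ ⊆ V + (F + H) := add_subset_add_left hF
    _ = F + V + H := by rw [← add_assoc, add_comm V F]

theorem encard_inter_closedBall_nonempty_mul_volume_le (hD : MeasurableSet D) {a b d : ℝ}
    (ha : ∀ x ∈ F, ‖x‖ ≤ a) (hb : ∀ x ∈ H, ‖x‖ ≤ b) (hd : ∀ x ∈ D, ‖x‖ ≤ d)
    (hV : V.PairwiseDisjoint fun v => v +ᵥ D) (R : ℝ) :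
    ({t ∈ (F : Set (EuclideanSpace ℝ (Fin n))) + V |
        ((t +ᵥ H) ∩ Metric.closedBall 0 R).Nonempty}.encard : ℝ≥0∞) * volume D ≤
      F.card * volume (Metric.closedBall (0 : EuclideanSpace ℝ (Fin n)) (R + (a + b + d))) := by
  set W := {v ∈ V | v +ᵥ D ⊆ Metric.closedBall 0 (R + (a + b + d))}
  have hsub : {t ∈ (F : Set (EuclideanSpace ℝ (Fin n))) + V |
      ((t +ᵥ H) ∩ Metric.closedBall 0 R).Nonempty} ⊆
      (fun p => p.1 + p.2) '' ((F : Set (EuclideanSpace ℝ (Fin n))) ×ˢ W) := by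
    rintro _ ⟨⟨t, ht, v, hv, rfl⟩, _, ⟨y, hy, rfl⟩, hyR⟩
    refine ⟨(t, v), ⟨ht, hv, ?_⟩, rfl⟩
    rintro _ ⟨x, hx, rfl⟩
    rw [mem_closedBall_zero_iff] at hyR ⊢
    calc ‖v + x‖ = ‖(t + v + y) - (t + y) + x‖ := by congr 1; abel
      _ ≤ ‖t + v + y‖ + (‖t‖ + ‖y‖) + ‖x‖ :=
          (norm_add_le _ _).trans (by grw [norm_sub_le, norm_add_le t y])
      _ ≤ R + (a + b + d) := by linarith [show ‖t + v + y‖ ≤ R from hyR, ha t ht, hb y hy, hd x hx]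
  have hcard := (encard_le_encard hsub).trans (encard_image_le _ _)
  rw [encard_prod, encard_coe_eq_coe_finsetCard, ← ENat.toENNReal_le, ENat.toENNReal_mul,
    ENat.toENNReal_coe] at hcard
  grw [hcard, mul_assoc, encard_mul_measure_le_of_pairwiseDisjoint_vadd (μ := volume) hD
    (hV.subset (sep_subset _ _)) fun v hv => hv.2]

theorem coveringDensity_le_of_tiling (hH : Bornology.IsBounded H) (hD : MeasurableSet D)
    (hDb : Bornology.IsBounded D) (hD0 : volume D ≠ 0)
    (hV : V.PairwiseDisjoint fun v => v +ᵥ D) (hVD : ⋃ v ∈ V, (v +ᵥ D) = univ)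
    (hF : D ⊆ ⋃ t ∈ F, (t +ᵥ H)) :
    coveringDensity H ≤ F.card * volume H / volume D := by
  obtain ⟨a, ha⟩ := F.finite_toSet.isBounded.exists_norm_le
  obtain ⟨b, hb⟩ := hH.exists_norm_le
  obtain ⟨d, hd⟩ := hDb.exists_norm_le
  have hcover : coveringDensity H ≤ translateDensity H (F + V) :=
    iInf₂_le (f := fun Λ _ => translateDensity H Λ) _ (iUnion_vadd_add_eq_univ hVD hF)
  refine hcover.trans ?_
  have hlim := ENNReal.Tendsto.const_mul (a := (F.card : ℝ≥0∞) * volume H / volume D)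
    (tendsto_volume_closedBall_add_div (n := n) (a + b + d)) (Or.inl one_ne_zero)
  rw [mul_one] at hlim
  rw [translateDensity, ← hlim.liminf_eq]
  refine liminf_le_liminf (.of_forall fun R => ?_)
  have hcount := (ENNReal.le_div_iff_mul_le (Or.inl hD0) (Or.inl hDb.measure_lt_top.ne)).2
    (encard_inter_closedBall_nonempty_mul_volume_le hD ha hb hd hV R)
  grw [hcount]
  refine le_of_eq ?_
  simp only [div_eq_mul_inv]
  ring

end Tiling

/-- The half-open cube `[-s, s)ⁿ`, which tiles space exactly. -/
def halfOpenCube (n : ℕ) (s : ℝ) : Set (EuclideanSpace ℝ (Fin n)) :=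
  {x | ∀ i, x i ∈ Ico (-s) s}

/-- The lattice `2s ℤⁿ`, along which the cubes `halfOpenCube n s` tile space. -/
def cubeLattice (n : ℕ) (s : ℝ) : Set (EuclideanSpace ℝ (Fin n)) :=
  {v | ∀ i, ∃ z : ℤ, v i = 2 * s * z}

section HalfOpenCube

variable {n : ℕ} {s : ℝ}

theorem halfOpenCube_eq_preimage (n : ℕ) (s : ℝ) :
    halfOpenCube n s = WithLp.ofLp ⁻¹' (univ.pi fun _ : Fin n => Ico (-s) s) := by
  ext x
  simp [halfOpenCube]

theorem measurableSet_halfOpenCube (n : ℕ) (s : ℝ) : MeasurableSet (halfOpenCube n s) := by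
  rw [halfOpenCube_eq_preimage]
  exact (PiLp.volume_preserving_ofLp (Fin n)).measurable
    (MeasurableSet.univ_pi fun _ => measurableSet_Ico)

theorem volume_halfOpenCube (hs : 0 ≤ s) :
    volume (halfOpenCube n s) = ENNReal.ofReal ((2 * s) ^ n) := by
  rw [halfOpenCube_eq_preimage, (PiLp.volume_preserving_ofLp (Fin n)).measure_preimage
    (MeasurableSet.univ_pi fun _ => measurableSet_Ico).nullMeasurableSet, volume_pi_pi]
  simp only [Real.volume_Ico, Finset.prod_const, Finset.card_univ, Fintype.card_fin]
  rw [← ENNReal.ofReal_pow (by linarith), sub_neg_eq_add, two_mul]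

theorem volume_halfOpenCube_ne_zero (hs : 0 < s) : volume (halfOpenCube n s) ≠ 0 := by
  rw [volume_halfOpenCube hs.le]
  exact (ENNReal.ofReal_pos.2 (by positivity)).ne'

theorem add_mem_halfOpenCube {c : ℝ} {x y : EuclideanSpace ℝ (Fin n)}
    (hx : x ∈ halfOpenCube n s) (hy : ‖y‖ ≤ c) : x + y ∈ halfOpenCube n (s + c) := by
  intro i
  obtain ⟨hneg, hpos⟩ := abs_le.1 ((PiLp.norm_apply_le y i).trans hy)
  rw [PiLp.add_apply]
  exact ⟨by linarith [(hx i).1], by linarith [(hx i).2]⟩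

theorem isBounded_halfOpenCube (n : ℕ) (s : ℝ) : Bornology.IsBounded (halfOpenCube n s) := by
  refine isBounded_iff_forall_norm_le.2 ⟨n * s, fun x hx => ?_⟩
  calc ‖x‖ = √(∑ i, ‖x i‖ ^ 2) := EuclideanSpace.norm_eq x
    _ ≤ ∑ i, ‖x i‖ := Real.sqrt_le_iff.2 ⟨Finset.sum_nonneg fun _ _ => norm_nonneg _,
        Finset.sum_sq_le_sq_sum_of_nonneg fun _ _ => norm_nonneg _⟩
    _ ≤ ∑ _i : Fin n, s := Finset.sum_le_sum fun i _ => abs_le.2 ⟨(hx i).1, (hx i).2.le⟩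
    _ = n * s := by simp

theorem volume_halfOpenCube_ne_top (n : ℕ) (s : ℝ) : volume (halfOpenCube n s) ≠ ∞ :=
  (isBounded_halfOpenCube n s).measure_lt_top.ne

theorem pairwiseDisjoint_cubeLattice_vadd (n : ℕ) (s : ℝ) :
    (cubeLattice n s).PairwiseDisjoint fun v => v +ᵥ halfOpenCube n s := by
  intro v hv w hw hvw
  refine Set.disjoint_left.2 fun x hxv hxw => hvw (PiLp.ext fun i => ?_)
  rw [mem_vadd_set_iff_sub_mem] at hxv hxw
  obtain ⟨z, hz⟩ := hv i
  obtain ⟨u, hu⟩ := hw i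
  have hxz := hxv i
  have hxu := hxw i
  rw [PiLp.sub_apply, mem_Ico] at hxz hxu
  have hzu : (z : ℝ) - u < 1 := by nlinarith
  have huz : (u : ℝ) - z < 1 := by nlinarith
  have : z = u := by
    have h₁ : z - u < 1 := by exact_mod_cast hzu
    have h₂ : u - z < 1 := by exact_mod_cast huz
    omega
  rw [hz, hu, this]

theorem iUnion_cubeLattice_vadd (hs : 0 < s) :
    ⋃ v ∈ cubeLattice n s, (v +ᵥ halfOpenCube n s) = univ := by
  refine eq_univ_of_forall fun x => mem_iUnion₂.2
    ⟨WithLp.toLp 2 fun i => 2 * s * ⌊(x i + s) / (2 * s)⌋, fun i => ⟨_, rfl⟩,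
      mem_vadd_set_iff_sub_mem.2 fun i => ?_⟩
  have hfloor := Int.floor_le ((x i + s) / (2 * s))
  have hlt := Int.lt_floor_add_one ((x i + s) / (2 * s))
  rw [le_div_iff₀ (by positivity)] at hfloor
  rw [div_lt_iff₀ (by positivity)] at hlt
  rw [PiLp.sub_apply]
  constructor <;> linarith

theorem coveringDensity_le_of_cover_halfOpenCube {H : Set (EuclideanSpace ℝ (Fin n))}
    (hH : Bornology.IsBounded H) (hs : 0 < s) {F : Finset (EuclideanSpace ℝ (Fin n))}
    (hF : halfOpenCube n s ⊆ ⋃ t ∈ F, (t +ᵥ H)) :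
    coveringDensity H ≤ F.card * volume H / volume (halfOpenCube n s) :=
  coveringDensity_le_of_tiling hH (measurableSet_halfOpenCube n s) (isBounded_halfOpenCube n s)
    (volume_halfOpenCube_ne_zero hs) (pairwiseDisjoint_cubeLattice_vadd n s)
    (iUnion_cubeLattice_vadd hs) hF

end HalfOpenCube

section RogersCovering

variable {n : ℕ} {K : Set (EuclideanSpace ℝ (Fin n))} {η : ℝ}

theorem volume_real_smul_of_nonneg {r : ℝ} (hr : 0 ≤ r) (K : Set (EuclideanSpace ℝ (Fin n))) :
    volume.real (r • K) = r ^ n * volume.real K := by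
  rw [measureReal_def, Measure.addHaar_smul_of_nonneg _ hr, finrank_euclideanSpace_fin,
    ENNReal.toReal_mul, ENNReal.toReal_ofReal (by positivity), measureReal_def]

theorem IsSymmConvexBody.subset_iUnion_vadd_one_add_smul (hK : IsSymmConvexBody K) (hη0 : 0 ≤ η)
    (hη1 : η ≤ 1) {S S₁ F G : Set (EuclideanSpace ℝ (Fin n))}
    (hS : ∀ x ∈ S, ∀ k ∈ K, x + k ∈ S₁)
    (hG : ∀ x : EuclideanSpace ℝ (Fin n), x +ᵥ η • K ⊆ S₁ \ ⋃ a ∈ F, (a +ᵥ K) →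
      ∃ b ∈ G, ((x +ᵥ η • K) ∩ (b +ᵥ η • K)).Nonempty) :
    S ⊆ ⋃ t ∈ F ∪ G, (t +ᵥ (1 + η) • K) := by
  intro x hx
  suffices ∃ t ∈ F ∪ G, x - t ∈ (1 + η) • K by
    obtain ⟨t, ht, hxt⟩ := this
    exact mem_iUnion₂.2 ⟨t, ht, mem_vadd_set_iff_sub_mem.2 hxt⟩
  by_cases hxU : x +ᵥ η • K ⊆ S₁ \ ⋃ a ∈ F, (a +ᵥ K)
  · obtain ⟨b, hb, y, hyx, hyb⟩ := hG x hxU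
    rw [mem_vadd_set_iff_sub_mem] at hyx hyb
    have hmono : (η + η) • K ⊆ (1 + η) • K := hK.balanced.smul_mono <| by
      rw [Real.norm_of_nonneg (by positivity), Real.norm_of_nonneg (by positivity)]
      gcongr
    refine ⟨b, Or.inr hb, hmono ?_⟩
    simpa using hK.sub_mem_smul hη0 hη0 hyb hyx
  · obtain ⟨y, hyx, hyU⟩ := not_subset.1 hxU
    rw [mem_vadd_set_iff_sub_mem] at hyx
    have hyS₁ : y ∈ S₁ := by
      have hyK : y - x ∈ K := hK.balanced η (by rwa [Real.norm_of_nonneg hη0]) hyx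
      simpa using hS x hx _ hyK
    have hyF : y ∈ ⋃ a ∈ F, (a +ᵥ K) := by
      by_contra hyF
      exact hyU ⟨hyS₁, hyF⟩
    obtain ⟨a, ha, hya⟩ := mem_iUnion₂.1 hyF
    rw [mem_vadd_set_iff_sub_mem, ← one_smul ℝ K] at hya
    exact ⟨a, Or.inl ha, by simpa using hK.sub_mem_smul zero_le_one hη0 hya hyx⟩

theorem exp_neg_mul_log_one_div (n : ℕ) (hη : 0 < η) :
    Real.exp (-(n * Real.log (1 / η))) = η ^ n := by
  rw [one_div, Real.log_inv, mul_neg, neg_neg, Real.exp_nat_mul, Real.exp_log hη]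

theorem IsSymmConvexBody.exists_finset_subset_iUnion_vadd_one_add_smul (hK : IsSymmConvexBody K)
    (hη0 : 0 < η) (hη1 : η ≤ 1) {S S₁ S₂ : Set (EuclideanSpace ℝ (Fin n))}
    (hS : ∀ x ∈ S, ∀ k ∈ K, x + k ∈ S₁) (hS₁ : ∀ x ∈ S₁, ∀ k ∈ K, x - k ∈ S₂)
    (hS₁m : MeasurableSet S₁) (hS₂m : MeasurableSet S₂) (hS₁top : volume S₁ ≠ ∞)
    (hS₂0 : volume S₂ ≠ 0) (hS₂top : volume S₂ ≠ ∞) :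
    ∃ F : Finset (EuclideanSpace ℝ (Fin n)), S ⊆ ⋃ t ∈ F, (t +ᵥ (1 + η) • K) ∧
      F.card * volume.real K ≤
        n * Real.log (1 / η) * volume.real S₂ + volume.real K + volume.real S₁ := by
  classical
  have hlog : 0 ≤ Real.log (1 / η) := Real.log_nonneg (one_le_one_div hη0 hη1)
  obtain ⟨F, hFcard, hFrest⟩ := exists_finset_card_mul_le_measureReal_sdiff_le (μ := volume)
    hK.measurableSet hK.volume_ne_zero hK.volume_ne_top hS₂m hS₂0 hS₂top hS₁top hS₁m hS₁
    (mul_nonneg n.cast_nonneg hlog)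
  rw [exp_neg_mul_log_one_div n hη0] at hFrest
  set U := S₁ \ ⋃ a ∈ F, (a +ᵥ K)
  have hUtop : volume U ≠ ∞ := measure_ne_top_of_subset sdiff_subset hS₁top
  have hηK := hK.smul hη0.ne'
  obtain ⟨G, hGcard, hGmax⟩ :=
    exists_finset_maximal_packing hηK.measurableSet hηK.volume_ne_zero hUtop
  refine ⟨F ∪ G, ?_, ?_⟩
  · have hcover := hK.subset_iUnion_vadd_one_add_smul (F := F) (G := G) hη0.le hη1 hS hGmax
    simpa only [← Finset.coe_union, Finset.mem_coe] using hcover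
  have hG : G.card * volume.real K ≤ volume.real S₁ := by
    refine le_of_mul_le_mul_right ?_ (pow_pos hη0 n)
    calc G.card * volume.real K * η ^ n = G.card * volume.real (η • K) := by
          rw [volume_real_smul_of_nonneg hη0.le]; ring
      _ ≤ volume.real U := by simpa [measureReal_def] using ENNReal.toReal_mono hUtop hGcard
      _ ≤ volume.real S₁ * η ^ n := hFrest
  calc ((F ∪ G).card : ℝ) * volume.real K ≤ (F.card + G.card : ℕ) * volume.real K := by
        gcongr; exact Finset.card_union_le F G
    _ = F.card * volume.real K + G.card * volume.real K := by push_cast; ring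
    _ ≤ _ := add_le_add hFcard hG

theorem coveringDensity_one_add_smul_le (hK : IsSymmConvexBody K) (hη0 : 0 < η) (hη1 : η ≤ 1)
    {c : ℝ} (hc : ∀ k ∈ K, ‖k‖ ≤ c) {s : ℝ} (hs : 0 < s) :
    coveringDensity ((1 + η) • K) ≤ ENNReal.ofReal ((1 + η) ^ n *
      (n * Real.log (1 / η) * (1 + (c + c) / s) ^ n + volume.real K / (2 * s) ^ n +
        (1 + c / s) ^ n)) := by
  have hc0 : 0 ≤ c := (norm_nonneg _).trans (hc 0 hK.zero_mem)
  have hvol {r : ℝ} (hr : 0 ≤ r) : volume.real (halfOpenCube n r) = (2 * r) ^ n := by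
    rw [measureReal_def, volume_halfOpenCube hr, ENNReal.toReal_ofReal (by positivity)]
  have hratio (a : ℝ) : (1 + a / s) ^ n = (2 * (s + a)) ^ n / (2 * s) ^ n := by
    rw [← div_pow, mul_div_mul_left _ _ two_ne_zero, add_div, div_self hs.ne']
  obtain ⟨F, hF, hcard⟩ := hK.exists_finset_subset_iUnion_vadd_one_add_smul hη0 hη1
    (S := halfOpenCube n s) (S₁ := halfOpenCube n (s + c)) (S₂ := halfOpenCube n (s + c + c))
    (fun x hx k hk => add_mem_halfOpenCube hx (hc k hk))
    (fun x hx k hk => sub_eq_add_neg x k ▸ add_mem_halfOpenCube hx (by simpa using hc k hk))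
    (measurableSet_halfOpenCube n _) (measurableSet_halfOpenCube n _)
    (volume_halfOpenCube_ne_top n _) (volume_halfOpenCube_ne_zero (by positivity))
    (volume_halfOpenCube_ne_top n _)
  have hηK := hK.smul (by positivity : 1 + η ≠ 0)
  refine (coveringDensity_le_of_cover_halfOpenCube hηK.isCompact.isBounded hs hF).trans ?_
  rw [← ofReal_measureReal hηK.volume_ne_top,
    ← ofReal_measureReal (volume_halfOpenCube_ne_top n s), hvol hs.le, ← ENNReal.ofReal_natCast,
    ← ENNReal.ofReal_mul (by positivity), ← ENNReal.ofReal_div_of_pos (by positivity)]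
  refine ENNReal.ofReal_le_ofReal ?_
  rw [hvol (by positivity), hvol (by positivity)] at hcard
  rw [volume_real_smul_of_nonneg (by positivity)]
  calc F.card * ((1 + η) ^ n * volume.real K) / (2 * s) ^ n
      = (1 + η) ^ n * (F.card * volume.real K / (2 * s) ^ n) := by ring
    _ ≤ (1 + η) ^ n * ((n * Real.log (1 / η) * (2 * (s + c + c)) ^ n + volume.real K +
          (2 * (s + c)) ^ n) / (2 * s) ^ n) := by gcongr
    _ = _ := by rw [hratio, hratio, add_div, add_div, add_assoc s c c, mul_div_assoc]

theorem coveringDensity_le_rogers (hn : n ≠ 0) {H : Set (EuclideanSpace ℝ (Fin n))}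
    (hH : IsSymmConvexBody H) (hη0 : 0 < η) (hη1 : η ≤ 1) :
    coveringDensity H ≤ ENNReal.ofReal ((1 + η) ^ n * (1 + n * Real.log (1 / η))) := by
  have hη : 1 + η ≠ 0 := by positivity
  have hK := hH.smul (inv_ne_zero hη)
  obtain ⟨c, hc⟩ := hK.isCompact.isBounded.exists_norm_le
  have hvol : Tendsto (fun s : ℝ => volume.real ((1 + η)⁻¹ • H) / (2 * s) ^ n) atTop (nhds 0) :=
    tendsto_const_nhds.div_atTop
      ((tendsto_pow_atTop hn).comp (tendsto_id.const_mul_atTop two_pos))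
  have hlim := ENNReal.tendsto_ofReal <| ((((tendsto_one_add_div_pow_atTop n (c + c)).const_mul
    (n * Real.log (1 / η))).add hvol).add (tendsto_one_add_div_pow_atTop n c)).const_mul
      ((1 + η) ^ n)
  rw [mul_one, add_zero, add_comm _ (1 : ℝ)] at hlim
  refine ge_of_tendsto hlim ((eventually_gt_atTop 0).mono fun s hs => ?_)
  have hle := coveringDensity_one_add_smul_le hK hη0 hη1 hc hs
  rwa [smul_inv_smul₀ hη] at hle

end RogersCovering

section RogersBound

variable {n : ℕ}

theorem one_add_mul_log_one_div_nonneg (n : ℕ) {η : ℝ} (hη0 : 0 < η) (hη1 : η ≤ 1) :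
    0 ≤ 1 + n * Real.log (1 / η) :=
  add_nonneg zero_le_one
    (mul_nonneg n.cast_nonneg (Real.log_nonneg (one_le_one_div hη0 hη1)))

theorem one_add_mul_log_le_rogersBound (hn : n ≠ 0) : 1 + n * Real.log n ≤ rogersBound n := by
  refine le_csInf ((nonempty_Ioo.2 (by positivity)).image _) ?_
  rintro _ ⟨η, ⟨hη0, hηn⟩, rfl⟩
  have hlog : Real.log n ≤ Real.log (1 / η) :=
    Real.log_le_log (by positivity) ((le_one_div (by positivity) hη0).2 hηn.le)
  have hpow : 1 ≤ (1 + η) ^ n := one_le_pow₀ (by linarith)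
  have hnonneg : 0 ≤ 1 + n * Real.log n := by positivity
  calc 1 + n * Real.log n ≤ (1 + η) ^ n * (1 + n * Real.log n) :=
        le_mul_of_one_le_left hnonneg hpow
    _ ≤ (1 + η) ^ n * (1 + n * Real.log (1 / η)) := by gcongr

theorem one_le_rogersBound (hn : n ≠ 0) : 1 ≤ rogersBound n :=
  le_of_add_le_of_nonneg_left (one_add_mul_log_le_rogersBound hn) (by positivity)

theorem le_one_of_mem_Ioo_one_div {η : ℝ} (hη : η ∈ Ioo (0 : ℝ) (1 / n)) : η ≤ 1 :=
  hη.2.le.trans (by simpa using Nat.cast_inv_le_one n)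

theorem rogersBound_le {η : ℝ} (hη : η ∈ Ioo (0 : ℝ) (1 / n)) :
    rogersBound n ≤ (1 + η) ^ n * (1 + n * Real.log (1 / η)) := by
  refine csInf_le ⟨0, ?_⟩ (mem_image_of_mem _ hη)
  rintro _ ⟨ξ, hξ, rfl⟩
  have : 0 < ξ := hξ.1
  exact mul_nonneg (by positivity)
    (one_add_mul_log_one_div_nonneg n hξ.1 (le_one_of_mem_Ioo_one_div hξ))

theorem isUniversalCoveringBound_rogersBound (hn : n ≠ 0) :
    IsUniversalCoveringBound n (rogersBound n) := by
  intro H hH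
  have hle : ∀ η ∈ Ioo (0 : ℝ) (1 / n),
      coveringDensity H ≤ ENNReal.ofReal ((1 + η) ^ n * (1 + n * Real.log (1 / η))) :=
    fun η hη => coveringDensity_le_rogers hn hH hη.1 (le_one_of_mem_Ioo_one_div hη)
  have hne : (Ioo (0 : ℝ) (1 / n)).Nonempty := nonempty_Ioo.2 (by positivity)
  have htop : coveringDensity H ≠ ∞ :=
    hne.elim fun η hη => ((hle η hη).trans_lt ENNReal.ofReal_lt_top).ne
  rw [ENNReal.le_ofReal_iff_toReal_le htop (zero_le_one.trans (one_le_rogersBound hn))]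
  refine le_csInf (hne.image _) ?_
  rintro _ ⟨η, hη, rfl⟩
  have : 0 < η := hη.1
  exact ENNReal.toReal_le_of_le_ofReal (mul_nonneg (by positivity)
    (one_add_mul_log_one_div_nonneg n hη.1 (le_one_of_mem_Ioo_one_div hη))) (hle η hη)

theorem rogersBound_div_le (hn : n ≠ 0) (hlog : 1 < Real.log n) :
    rogersBound n / (n * Real.log n) ≤ Real.exp (1 / Real.log n) *
      (1 / (n * Real.log n) + 1 + Real.log (Real.log n) / Real.log n) := by
  have hlog0 : 0 < Real.log n := zero_lt_one.trans hlog
  have hloglog : 0 ≤ Real.log (Real.log n) := Real.log_nonneg hlog.le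
  -- The choice `η = 1 / (n log n)` is asymptotically optimal.
  have hη : 1 / (n * Real.log n) ∈ Ioo (0 : ℝ) (1 / n) := by
    refine ⟨by positivity, one_div_lt_one_div_of_lt (by positivity) ?_⟩
    exact lt_mul_of_one_lt_right (by positivity) hlog
  have hpow : (1 + 1 / (n * Real.log n)) ^ n ≤ Real.exp (1 / Real.log n) :=
    calc (1 + 1 / (n * Real.log n)) ^ n ≤ Real.exp (1 / (n * Real.log n)) ^ n := by
          gcongr
          rw [add_comm]
          exact Real.add_one_le_exp _
      _ = Real.exp (1 / Real.log n) := by rw [← Real.exp_nat_mul]; congr 1; field_simp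
  rw [div_le_iff₀ (by positivity)]
  calc rogersBound n ≤ (1 + 1 / (n * Real.log n)) ^ n *
        (1 + n * Real.log (1 / (1 / (n * Real.log n)))) := rogersBound_le hη
    _ = (1 + 1 / (n * Real.log n)) ^ n * (1 + n * (Real.log n + Real.log (Real.log n))) := by
        rw [one_div_one_div, Real.log_mul (by positivity) hlog0.ne']
    _ ≤ Real.exp (1 / Real.log n) * (1 + n * (Real.log n + Real.log (Real.log n))) := by gcongr
    _ = _ := by field_simp; ring

theorem tendsto_log_natCast_atTop : Tendsto (fun n : ℕ => Real.log n) atTop atTop :=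
  Real.tendsto_log_atTop.comp tendsto_natCast_atTop_atTop

theorem tendsto_rogersBound_div :
    Tendsto (fun n : ℕ => rogersBound n / (n * Real.log n)) atTop (nhds 1) := by
  have hlog := tendsto_log_natCast_atTop
  have hupper : Tendsto (fun n : ℕ => Real.exp (1 / Real.log n) *
      (1 / (n * Real.log n) + 1 + Real.log (Real.log n) / Real.log n)) atTop (nhds 1) := by
    have hexp : Tendsto (fun n : ℕ => Real.exp (1 / Real.log n)) atTop (nhds 1) := by
      simpa using (hlog.const_div_atTop 1).rexp
    have hinv : Tendsto (fun n : ℕ => 1 / (n * Real.log n)) atTop (nhds 0) :=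
      (tendsto_natCast_atTop_atTop.atTop_mul_atTop₀ hlog).const_div_atTop 1
    have hloglog := Real.isLittleO_log_id_atTop.tendsto_div_nhds_zero.comp hlog
    simpa using hexp.mul ((hinv.add_const 1).add hloglog)
  refine tendsto_of_tendsto_of_tendsto_of_le_of_le' tendsto_const_nhds hupper ?_ ?_
  · filter_upwards [eventually_ne_atTop 0, hlog.eventually_gt_atTop 0] with n hn hlog0
    rw [le_div_iff₀ (by positivity)]
    linarith [one_add_mul_log_le_rogersBound hn]
  · filter_upwards [eventually_ne_atTop 0, hlog.eventually_gt_atTop 1] with n hn hlog1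
    exact rogersBound_div_le hn hlog1

end RogersBound

/-- The function `f` of the theorem: the expression prescribed for `n ≥ 3` vanishes at `n = 2`, so
for `n ≤ 2` it is replaced by the gain `2 / (e (n + 2) Θₙ)` that the covering argument gives in
every dimension. -/
noncomputable def deficitConstant (n : ℕ) : ℝ :=
  if n ≤ 2 then 2 / (Real.exp 1 * (n + 2) * rogersBound n)
  else 2 * (1 - 2 / (n : ℝ)) / (Real.exp 1 * n * rogersBound n)

section DeficitConstant

variable {n : ℕ}

theorem two_mul_one_sub_div_le {T : ℝ} (hT : 0 < T) (n : ℕ) :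
    2 * (1 - 2 / (n : ℝ)) / (Real.exp 1 * n * T) ≤ 2 / (Real.exp 1 * (n + 2) * T) := by
  rcases eq_or_ne n 0 with rfl | hn
  · simp only [CharP.cast_eq_zero, mul_zero, zero_mul, div_zero]
    positivity
  have hprod : (1 - 2 / (n : ℝ)) * (n + 2) ≤ n := by
    have heq : (1 - 2 / (n : ℝ)) * (n + 2) = n - 4 / n := by field_simp; ring
    linarith [show 0 < 4 / (n : ℝ) by positivity]
  rw [div_le_div_iff₀ (by positivity) (by positivity)]
  calc 2 * (1 - 2 / (n : ℝ)) * (Real.exp 1 * (n + 2) * T)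
      = 2 * (Real.exp 1 * T) * ((1 - 2 / (n : ℝ)) * (n + 2)) := by ring
    _ ≤ 2 * (Real.exp 1 * T) * n := by gcongr
    _ = 2 * (Real.exp 1 * n * T) := by ring

theorem deficitConstant_of_three_le (hn : 3 ≤ n) :
    deficitConstant n = 2 * (1 - 2 / (n : ℝ)) / (Real.exp 1 * n * rogersBound n) :=
  if_neg (by omega)

theorem deficitConstant_le (hn : n ≠ 0) :
    deficitConstant n ≤ 2 / (Real.exp 1 * (n + 2) * rogersBound n) := by
  unfold deficitConstant
  split_ifs
  · exact le_rfl
  · exact two_mul_one_sub_div_le (zero_lt_one.trans_le (one_le_rogersBound hn)) n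

theorem deficitConstant_pos (hn : n ≠ 0) : 0 < deficitConstant n := by
  have hΘ : 0 < rogersBound n := zero_lt_one.trans_le (one_le_rogersBound hn)
  unfold deficitConstant
  split_ifs with h
  · positivity
  · have : 0 < 1 - 2 / (n : ℝ) := by
      rw [sub_pos, div_lt_one (by positivity)]
      exact_mod_cast not_le.1 h
    positivity

theorem deficitConstant_mem_Ioc (hn : n ≠ 0) : deficitConstant n ∈ Ioc (0 : ℝ) 1 := by
  refine ⟨deficitConstant_pos hn, (deficitConstant_le hn).trans ?_⟩
  have hΘ := one_le_rogersBound hn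
  have he : 1 ≤ Real.exp 1 := Real.one_le_exp zero_le_one
  rw [div_le_one (by positivity)]
  calc (2 : ℝ) = 1 * 2 * 1 := by norm_num
    _ ≤ Real.exp 1 * (n + 2) * rogersBound n := by gcongr; simp

theorem isEquivalent_deficitConstant :
    deficitConstant ~[atTop] fun n : ℕ => 2 / (Real.exp 1 * (n : ℝ) ^ 2 * Real.log n) := by
  refine Asymptotics.isEquivalent_of_tendsto_one ?_
  have hfactor : Tendsto (fun n : ℕ => 1 - 2 / (n : ℝ)) atTop (nhds 1) := by
    simpa using (tendsto_const_div_atTop_nhds_zero_nat (2 : ℝ)).const_sub 1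
  have hlim := hfactor.mul (tendsto_rogersBound_div.inv₀ one_ne_zero)
  rw [inv_one, mul_one] at hlim
  refine hlim.congr' ?_
  filter_upwards [eventually_ge_atTop 3] with n hn
  have hlog : Real.log n ≠ 0 := (Real.log_pos (by exact_mod_cast (by omega : 1 < n))).ne'
  have hΘ : rogersBound n ≠ 0 := (zero_lt_one.trans_le (one_le_rogersBound (by omega))).ne'
  rw [Pi.div_apply, deficitConstant_of_three_le hn]
  field_simp

end DeficitConstant

theorem theorem2_general :
    (∀ n : ℕ, n ≠ 0 →
      IsUniversalCoveringBound n (rogersBound n) ∧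
      ∀ T : ℝ, IsUniversalCoveringBound n T →
        ∀ (E : Type*) [NormedAddCommGroup E] [NormedSpace ℝ E] [MeasurableSpace E]
          [OpensMeasurableSpace E] (ν : Measure E),
          Module.finrank ℝ E = n → ν (Metric.closedBall (0 : E) 1) ≤ 1 →
          avgSelfDist ν < 2 * (1 - (2 : ℝ)⁻¹ ^ n *
            (2 * (1 - 2 / (n : ℝ)) / (Real.exp 1 * n * T)))) ∧
    ∃ f : ℕ → ℝ,
      (∀ n : ℕ, n ≠ 0 → f n ∈ Ioc (0 : ℝ) 1) ∧
      (∀ n : ℕ, 3 ≤ n →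
        f n = 2 * (1 - 2 / (n : ℝ)) / (Real.exp 1 * n * rogersBound n)) ∧
      (f ~[atTop] fun n : ℕ => 2 / (Real.exp 1 * (n : ℝ) ^ 2 * Real.log n)) ∧
      ∀ n : ℕ, n ≠ 0 →
        ∀ (E : Type*) [NormedAddCommGroup E] [NormedSpace ℝ E] [MeasurableSpace E]
          [OpensMeasurableSpace E] (ν : Measure E),
          Module.finrank ℝ E = n → ν (Metric.closedBall (0 : E) 1) ≤ 1 →
          avgSelfDist ν < 2 * (1 - (2 : ℝ)⁻¹ ^ n * f n) := by
  refine ⟨fun n hn => ⟨isUniversalCoveringBound_rogersBound hn, ?_⟩, deficitConstant,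
    fun n => deficitConstant_mem_Ioc, fun n => deficitConstant_of_three_le,
    isEquivalent_deficitConstant, ?_⟩
  · intro T hT E _ _ _ _ ν hE hν
    exact hT.avgSelfDist_lt_of_le hn (two_mul_one_sub_div_le hT.pos n) hE hν
  · intro n hn E _ _ _ _ ν hE hν
    exact (isUniversalCoveringBound_rogersBound hn).avgSelfDist_lt_of_le hn
      (deficitConstant_le hn) hE hν

theorem theorem2 :
    (∀ n : ℕ, 3 ≤ n →
      -- Rogers' quantity is a universal bound for translative covering densities
      IsUniversalCoveringBound n (rogersBound n) ∧
      -- the estimate, with Rogers' quantity and with any other universal bound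
      ∀ (E : Type*) [NormedAddCommGroup E] [NormedSpace ℝ E] [MeasurableSpace E] [BorelSpace E]
        (ν : Measure E) [IsProbabilityMeasure ν],
        Module.finrank ℝ E = n → ν (Metric.closedBall (0 : E) 1)ᶜ = 0 →
        avgSelfDist ν < 2 * (1 - (2 : ℝ)⁻¹ ^ n *
          (2 * (1 - 2 / (n : ℝ)) / (Real.exp 1 * n * rogersBound n))) ∧
        ∀ T : ℝ, IsUniversalCoveringBound n T →
          avgSelfDist ν < 2 * (1 - (2 : ℝ)⁻¹ ^ n *
            (2 * (1 - 2 / (n : ℝ)) / (Real.exp 1 * n * T)))) ∧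
    ∃ f : ℕ → ℝ,
      (∀ n : ℕ, 2 ≤ n → f n ∈ Ioc (0 : ℝ) 1) ∧
      (∀ n : ℕ, 3 ≤ n →
        f n = 2 * (1 - 2 / (n : ℝ)) / (Real.exp 1 * n * rogersBound n)) ∧
      (f ~[atTop] fun n : ℕ => 2 / (Real.exp 1 * (n : ℝ) ^ 2 * Real.log n)) ∧
      ∀ n : ℕ, 2 ≤ n →
        ∀ (E : Type*) [NormedAddCommGroup E] [NormedSpace ℝ E] [MeasurableSpace E] [BorelSpace E]
          (ν : Measure E) [IsProbabilityMeasure ν],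
          Module.finrank ℝ E = n → ν (Metric.closedBall (0 : E) 1)ᶜ = 0 →
          avgSelfDist ν ≤ 2 * (1 - (2 : ℝ)⁻¹ ^ n * f n) := by
  obtain ⟨ha, f, hf01, hf, hfequiv, hb⟩ := theorem2_general
  exact ⟨fun n hn => ⟨(ha n (by omega)).1, fun E _ _ _ _ ν _ hE _ =>
      ⟨(ha n (by omega)).2 _ (ha n (by omega)).1 E ν hE prob_le_one,
        fun T hT => (ha n (by omega)).2 T hT E ν hE prob_le_one⟩⟩,
    f, fun n hn => hf01 n (by omega), hf, hfequiv,
    fun n hn E _ _ _ _ ν _ hE _ => (hb n (by omega) E ν hE prob_le_one).le⟩
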